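/- Let $\mathbb{F}$ be a field. An ACI-matrix over $\mathbb{F}$ is a matrix whose entries are polynomials over $\mathbb{F}$ of degree at most one in some indeterminates, such that no indeterminate appears in two different columns. A completion of it is the constant matrix obtained by assigning values in $\mathbb{F}$ to all indeterminates, and it has constant rank $\rho$ if all its completions have rank $\rho$. An $m\times n$ ACI-matrix is full rank if it has constant rank $\min\{m,n\}$. It is minimal full rank if it is full rank, $m<n$, and no matrix obtained from it by deleting one column is full rank; it is maximal full rank if it is full rank, $n<m$, and for no $v\in\mathbb{F}^m$ is the matrix obtained from it by adjoining the constant column $v$ full rank. Two $m\times n$ ACI-matrices $A$ and $B$ are equivalent, $A\sim B$, if $TAQ=B$ for some nonsingular constant matrix $T$ of order $m$ and some permutation matrix $Q$ of order $n$. An ACI-matrix of constant rank $\rho$ is irreducible if no matrix obtained from it by deleting one row or one column has constant rank $\rho$, and it is completely irreducible if every ACI-matrix equivalent to it is irreducible. Theorem. Let $A$ be an $m\times n$ ACI-matrix over a field $\mathbb{F}$ and let $\rho$ be an integer with $1\le\rho<\min\{m,n\}$. Then $A$ is completely irreducible of constant rank $\rho$ if and only if there are positive integers $\rho_1,\rho_2$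 with $\rho_1+\rho_2=\rho$ such that $$A\sim\begin{bmatrix}A_{11}&*\\0&A_{22}\end{bmatrix},$$ where $A_{11}$ is minimal full rank of constant rank $\rho_1$ and $A_{22}$ is maximal full rank of constant rank $\rho_2$. -/

import Mathlib

namespace ACI

open MvPolynomial

/-- A matrix over `F[x_k : k ∈ σ]` is an ACI-matrix if its entries have degree at most one and no
indeterminate appears in two different columns. -/
structure IsACI {F : Type*} [Field F] {σ μ ν : Type*}
    (A : Matrix μ ν (MvPolynomial σ F)) : Prop where
  degree_le_one : ∀ i j, (A i j).totalDegree ≤ 1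
  independent : ∀ j j', j ≠ j' → ∀ i i', ∀ x ∈ (A i j).vars, x ∉ (A i' j').vars

/-- The completion of `A` given by an assignment of values in `F` to the indeterminates. -/
noncomputable def completion {F : Type*} [Field F] {σ μ ν : Type*}
    (A : Matrix μ ν (MvPolynomial σ F)) (x : σ → F) : Matrix μ ν F :=
  A.map (eval x)

/-- The rank of `A`: the set of the ranks of all completions of `A`. -/
noncomputable def rankSet {F : Type*} [Field F] {σ μ ν : Type*} [Fintype ν]
    (A : Matrix μ ν (MvPolynomial σ F)) : Set ℕ :=
  Set.range fun x : σ → F => (completion A x).rank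

/-- `A` has constant rank `ρ`. -/
def HasConstantRank {F : Type*} [Field F] {σ μ ν : Type*} [Fintype ν]
    (A : Matrix μ ν (MvPolynomial σ F)) (ρ : ℕ) : Prop :=
  rankSet A = {ρ}

/-- `A` has constant rank `min {m, n}`, where `m × n` is its size. -/
def IsFullRank {F : Type*} [Field F] {σ μ ν : Type*} [Fintype μ] [Fintype ν]
    (A : Matrix μ ν (MvPolynomial σ F)) : Prop :=
  HasConstantRank A (min (Fintype.card μ) (Fintype.card ν))

/-- Deletion of the row `i`. -/
def deleteRow {R μ ν : Type*} (A : Matrix μ ν R) (i : μ) : Matrix {k : μ // k ≠ i} ν R :=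
  A.submatrix Subtype.val id

/-- Deletion of the column `j`. -/
def deleteCol {R μ ν : Type*} (A : Matrix μ ν R) (j : ν) : Matrix μ {k : ν // k ≠ j} R :=
  A.submatrix id Subtype.val

/-- The augmented matrix `[A v]` with a constant last column `v`. -/
noncomputable def augment {F : Type*} [Field F] {σ μ ν : Type*}
    (A : Matrix μ ν (MvPolynomial σ F)) (v : μ → F) :
    Matrix μ (ν ⊕ Unit) (MvPolynomial σ F) :=
  Matrix.fromCols A (Matrix.replicateCol Unit fun i => C (v i))

/-- `A` is full rank with fewer rows than columns, and no matrix obtained by deleting one column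
is full rank. -/
def IsMinimalFullRank {F : Type*} [Field F] {σ μ ν : Type*} [Fintype μ] [Fintype ν]
    [DecidableEq ν] (A : Matrix μ ν (MvPolynomial σ F)) : Prop :=
  IsFullRank A ∧ Fintype.card μ < Fintype.card ν ∧ ∀ j : ν, ¬ IsFullRank (deleteCol A j)

/-- `A` is full rank with fewer columns than rows, and no matrix obtained by adjoining one constant
column is full rank. -/
def IsMaximalFullRank {F : Type*} [Field F] {σ μ ν : Type*} [Fintype μ] [Fintype ν]
    (A : Matrix μ ν (MvPolynomial σ F)) : Prop :=
  IsFullRank A ∧ Fintype.card ν < Fintype.card μ ∧ ∀ v : μ → F, ¬ IsFullRank (augment A v)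

/-- Equivalence of ACI-matrices of the same size: `T A Q = B` for some nonsingular constant matrix
`T` and some permutation matrix `Q`. -/
def Equivalent {F : Type*} [Field F] {σ μ ν : Type*} [Fintype μ] [DecidableEq μ] [Fintype ν]
    [DecidableEq ν] (A B : Matrix μ ν (MvPolynomial σ F)) : Prop :=
  IsACI A ∧ IsACI B ∧ ∃ (T : Matrix μ μ F) (Q : Equiv.Perm ν), T.det ≠ 0 ∧
    T.map (C : F →+* MvPolynomial σ F) * A * Q.permMatrix (MvPolynomial σ F) = B

/-- `A` has some constant rank, which is kept after the deletion of some row. -/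
def IsRowReducible {F : Type*} [Field F] {σ μ ν : Type*} [Fintype ν]
    (A : Matrix μ ν (MvPolynomial σ F)) : Prop :=
  ∃ ρ, HasConstantRank A ρ ∧ ∃ i, HasConstantRank (deleteRow A i) ρ

/-- `A` has some constant rank, which is kept after the deletion of some column. -/
def IsColReducible {F : Type*} [Field F] {σ μ ν : Type*} [Fintype ν] [DecidableEq ν]
    (A : Matrix μ ν (MvPolynomial σ F)) : Prop :=
  ∃ ρ, HasConstantRank A ρ ∧ ∃ j, HasConstantRank (deleteCol A j) ρ

/-- `A` has some constant rank and is neither row reducible nor column reducible. -/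
def IsIrreducible {F : Type*} [Field F] {σ μ ν : Type*} [Fintype ν] [DecidableEq ν]
    (A : Matrix μ ν (MvPolynomial σ F)) : Prop :=
  (∃ ρ, HasConstantRank A ρ) ∧ ¬ IsRowReducible A ∧ ¬ IsColReducible A

/-- `A` has some constant rank and each ACI-matrix equivalent to `A` is irreducible. -/
def IsCompletelyIrreducible {F : Type*} [Field F] {σ μ ν : Type*} [Fintype μ] [DecidableEq μ]
    [Fintype ν] [DecidableEq ν] (A : Matrix μ ν (MvPolynomial σ F)) : Prop :=
  (∃ ρ, HasConstantRank A ρ) ∧ ∀ B, Equivalent A B → IsIrreducible B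

/-- The `m × n` block upper triangular matrix with diagonal blocks `A₁₁`, of size `p × q`, and
`A₂₂`, of size `r × s`, upper right block `A₁₂` and lower left block zero. -/
def blockUpper {R : Type*} [Zero R] {m n p q r s : ℕ} (hm : p + r = m) (hn : q + s = n)
    (A₁₁ : Matrix (Fin p) (Fin q) R) (A₁₂ : Matrix (Fin p) (Fin s) R)
    (A₂₂ : Matrix (Fin r) (Fin s) R) : Matrix (Fin m) (Fin n) R :=
  Matrix.reindex (finSumFinEquiv.trans (finCongr hm)) (finSumFinEquiv.trans (finCongr hn))
    (Matrix.fromBlocks A₁₁ A₁₂ 0 A₂₂)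

end ACI

/-! Distinct columns share no indeterminate, so each column can be completed on its own, and the
completions of `A` are the transversals of the sets `X j` of completions of its columns. Since no
transversal has rank above `ρ < n`, the defect form of Rado's theorem gives a set `J` of `q` columns
whose completions span a space `U` of dimension `p`, with `p + s ≤ ρ` for `s = n - q`. Moving `J` to
the front and `U` onto the first `p` coordinates produces a zero lower left block. The ranks of the
diagonal blocks are at most `p` and `s`, so constant rank `ρ` forces `p + s = ρ` and makes both
blocks full rank (`IsACI.exists_equivalent_blockUpper`).

Complete irreducibility is the equivalence-invariant condition `Tight` on the family of completions:
each column matters for some completion, and each vector is in the column space of some completion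
(`isCompletelyIrreducible_iff_tight`). For a block triangular family with full rank blocks, the
column condition only concerns `A₁₁`, where it is minimality, and the vector condition only concerns
`A₂₂`, where it is maximality (`tight_fromBlocks_iff`). -/

namespace ACI

open MvPolynomial Module

/-! ### Independent transversals -/

/-- The defect form of Rado's theorem on independent transversals, for finite sets of vectors. -/
theorem exists_transversal_finrank_of_finset {F V ν : Type*} [Field F] [AddCommGroup V] [Module F V]
    [FiniteDimensional F V] [Fintype ν] (d N : ℕ) :
    ∀ X : ν → Finset V, ∑ j, (X j).card = N → (∀ j, (X j).Nonempty) →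
      (∀ J : Finset ν, J.card ≤ finrank F (Submodule.span F (⋃ j ∈ J, (X j : Set V))) + d) →
      ∃ v : ν → V, (∀ j, v j ∈ X j) ∧
        Fintype.card ν ≤ finrank F (Submodule.span F (Set.range v)) + d := by
  classical
  induction N using Nat.strong_induction_on with
  | _ N ih =>
    -- Induction on the total size of the sets: an element of some `X k` is discarded until all are
    -- singletons, where the hypothesis for all indices is the claim.
    intro X hN hne hX
    by_cases hsub : ∀ j, (X j).card ≤ 1
    · choose v hv using hne
      refine ⟨v, hv, ?_⟩
      have hXv : ∀ j, X j = {v j} := fun j =>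
        Finset.eq_singleton_iff_unique_mem.2
          ⟨hv j, fun w hw => Finset.card_le_one.1 (hsub j) _ hw _ (hv j)⟩
      have h := hX Finset.univ
      have hU : (⋃ j ∈ (Finset.univ : Finset ν), (X j : Set V)) = Set.range v := by
        ext w
        simp [hXv, eq_comm]
      rwa [hU, Finset.card_univ] at h
    · push Not at hsub
      obtain ⟨k, hk⟩ := hsub
      obtain ⟨x, hx, y, hy, hxy⟩ := Finset.one_lt_card.1 hk
      -- If removing `z` from `X k` breaks the hypothesis, it does so at some `J` not containing `k`.
      have key : ∀ z ∈ X k,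
          (∃ v : ν → V, (∀ j, v j ∈ X j) ∧
            Fintype.card ν ≤ finrank F (Submodule.span F (Set.range v)) + d) ∨
          ∃ J : Finset ν, k ∉ J ∧ finrank F ((Submodule.span F (⋃ j ∈ J, (X j : Set V))) ⊔
            Submodule.span F ((X k).erase z : Set V) : Submodule F V) + d ≤ J.card := by
        intro z hz
        by_cases hJ : ∀ J : Finset ν, J.card ≤ finrank F (Submodule.span F
            (⋃ j ∈ J, (Function.update X k ((X k).erase z) j : Set V))) + d
        · left
          have hle : ∀ j, Function.update X k ((X k).erase z) j ⊆ X j := by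
            intro j
            by_cases h : j = k
            · subst h; simp [Finset.erase_subset]
            · simp [h]
          obtain ⟨v, hv, hvcard⟩ := ih (∑ j, (Function.update X k ((X k).erase z) j).card) (by
              rw [← hN]
              refine Finset.sum_lt_sum (fun j _ => Finset.card_le_card (hle j))
                ⟨k, Finset.mem_univ _, ?_⟩
              simpa using Finset.card_erase_lt_of_mem hz) _ rfl (by
              intro j
              by_cases h : j = k
              · subst h
                simp only [Function.update_self]
                rw [← Finset.card_pos, Finset.card_erase_of_mem hz]
                omega
              · simpa [h] using hne j) hJ
          exact ⟨v, fun j => hle j (hv j), hvcard⟩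
        · right
          push Not at hJ
          obtain ⟨J, hJ⟩ := hJ
          have hkJ : k ∈ J := by
            by_contra hkJ
            have : (⋃ j ∈ J, (Function.update X k ((X k).erase z) j : Set V)) =
                ⋃ j ∈ J, (X j : Set V) := by
              refine Set.iUnion₂_congr fun j hj => ?_
              rw [Function.update_of_ne (by rintro rfl; exact hkJ hj)]
            rw [this] at hJ
            exact absurd (hX J) (by omega)
          refine ⟨J.erase k, by simp, ?_⟩
          have : (⋃ j ∈ J, (Function.update X k ((X k).erase z) j : Set V)) =
              (⋃ j ∈ J.erase k, (X j : Set V)) ∪ ((X k).erase z : Set V) := by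
            rw [← Finset.insert_erase hkJ, Finset.set_biUnion_insert, Finset.erase_insert (by simp),
              Function.update_self, Set.union_comm]
            congr 1
            refine Set.iUnion₂_congr fun j hj => ?_
            rw [Function.update_of_ne (Finset.ne_of_mem_erase hj)]
          rw [this, Submodule.span_union] at hJ
          rw [Finset.card_erase_of_mem hkJ]
          omega
      rcases key x hx with h | ⟨J, hkJ, hJ⟩
      · exact h
      rcases key y hy with h | ⟨K, hkK, hK⟩
      · exact h
      -- Submodularity of dimension: `P ⊔ Q` contains all of `X k` because `x ≠ y`, so `hX` at
      -- `insert k (J ∪ K)` and at `J ∩ K` gives `dim P + dim Q + 2d ≥ |J| + |K| + 1`, against `hJ`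
      -- and `hK`.
      exfalso
      set P := Submodule.span F (⋃ j ∈ J, (X j : Set V)) ⊔
            Submodule.span F ((X k).erase x : Set V) with hP
      set Q := Submodule.span F (⋃ j ∈ K, (X j : Set V)) ⊔
            Submodule.span F ((X k).erase y : Set V) with hQ
      have hsup : Submodule.span F (⋃ j ∈ insert k (J ∪ K), (X j : Set V)) ≤ P ⊔ Q := by
        rw [Submodule.span_le]
        intro w hw
        simp only [Set.mem_iUnion, Finset.mem_insert, Finset.mem_union, exists_prop] at hw
        obtain ⟨j, rfl | hj | hj, hw⟩ := hw
        · by_cases hwx : w = x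
          · exact Submodule.mem_sup_right (Submodule.mem_sup_right
              (Submodule.subset_span (by subst hwx; simpa [hxy] using hw)))
          · exact Submodule.mem_sup_left (Submodule.mem_sup_right
              (Submodule.subset_span (by simpa [hwx] using hw)))
        · exact Submodule.mem_sup_left (Submodule.mem_sup_left
              (Submodule.subset_span (Set.mem_biUnion (Finset.mem_coe.2 hj) hw)))
        · exact Submodule.mem_sup_right (Submodule.mem_sup_left
              (Submodule.subset_span (Set.mem_biUnion (Finset.mem_coe.2 hj) hw)))
      have hinf : Submodule.span F (⋃ j ∈ J ∩ K, (X j : Set V)) ≤ P ⊓ Q := by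
        refine le_inf (le_sup_of_le_left (Submodule.span_mono ?_))
          (le_sup_of_le_left (Submodule.span_mono ?_)) <;>
        exact Set.biUnion_subset_biUnion_left (by intro j; simp +contextual)
      have h1 := Submodule.finrank_mono hsup
      have h2 := Submodule.finrank_mono hinf
      have h3 := Submodule.finrank_sup_add_finrank_inf_eq P Q
      have h4 := hX (insert k (J ∪ K))
      have h5 := hX (J ∩ K)
      rw [Finset.card_insert_of_notMem (by simp [hkJ, hkK])] at h4
      have h6 := Finset.card_union_add_card_inter J K
      omega

/-- The defect form of Rado's theorem on independent transversals, for sets of vectors. -/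
theorem exists_transversal_finrank {F V ν : Type*} [Field F] [AddCommGroup V] [Module F V]
    [FiniteDimensional F V] [Fintype ν] (d : ℕ) (X : ν → Set V) (hne : ∀ j, (X j).Nonempty)
    (hX : ∀ J : Finset ν, J.card ≤ finrank F (Submodule.span F (⋃ j ∈ J, X j)) + d) :
    ∃ v : ν → V, (∀ j, v j ∈ X j) ∧
      Fintype.card ν ≤ finrank F (Submodule.span F (Set.range v)) + d := by
  classical
  have hfin : ∀ j, ∃ Y : Finset V, Y.Nonempty ∧ (Y : Set V) ⊆ X j ∧
      X j ⊆ Submodule.span F (Y : Set V) := by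
    intro j
    obtain ⟨Y, hYX, hY⟩ := (Submodule.fg_span_iff_fg_span_finset_subset (R := F) (X j)).1
      (IsNoetherian.noetherian _)
    obtain ⟨w, hw⟩ := hne j
    -- `Y` itself may be empty, when `X j = {0}`.
    refine ⟨insert w Y, by simp, by simpa [Set.insert_subset_iff, hw] using hYX, ?_⟩
    intro u hu
    have : u ∈ Submodule.span F (X j) := Submodule.subset_span hu
    rw [hY] at this
    exact Submodule.span_mono (by simp) this
  choose Y hYne hYX hXY using hfin
  obtain ⟨v, hv, hvcard⟩ := exists_transversal_finrank_of_finset (F := F) d _ Y rfl hYne (by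
    intro J
    refine (hX J).trans (Nat.add_le_add_right (Submodule.finrank_mono ?_) d)
    rw [Submodule.span_le]
    refine Set.iUnion₂_subset fun j hj => (hXY j).trans ?_
    exact Submodule.span_mono (Set.subset_biUnion_of_mem (u := fun j => (Y j : Set V))
      (Finset.mem_coe.2 hj)))
  exact ⟨v, fun j => hYX j (hv j), hvcard⟩

/-! ### Ranks of constant matrices -/

section Rank

variable {F : Type*} [Field F] {μ ν κ τ : Type*} [Fintype ν] [Fintype τ]

theorem rank_eq_card_height_iff [Fintype μ] (M : Matrix μ ν F) :
    M.rank = Fintype.card μ ↔ ∀ w, ∃ c, M.mulVec c = w := by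
  have : M.rank = Fintype.card μ ↔ LinearMap.range M.mulVecLin = ⊤ := by
    rw [Matrix.rank, ← Module.finrank_fintype_fun_eq_card F]
    exact ⟨Submodule.eq_top_of_finrank_eq, fun h => by rw [h, finrank_top]⟩
  rw [this, LinearMap.range_eq_top]
  rfl

theorem rank_eq_card_width_iff (M : Matrix μ ν F) :
    M.rank = Fintype.card ν ↔ ∀ c, M.mulVec c = 0 → c = 0 := by
  have h := M.mulVecLin.finrank_range_add_finrank_ker
  rw [Module.finrank_fintype_fun_eq_card] at h
  have : M.rank = Fintype.card ν ↔ LinearMap.ker M.mulVecLin = ⊥ := by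
    rw [Matrix.rank, ← Submodule.finrank_eq_zero (R := F)]
    omega
  rw [this, LinearMap.ker_eq_bot']
  rfl

theorem rank_add_le [Finite μ] (M N : Matrix μ ν F) : (M + N).rank ≤ M.rank + N.rank := by
  refine le_trans (Submodule.finrank_mono ?_) (Submodule.finrank_add_le_finrank_add_finrank
    (LinearMap.range M.mulVecLin) (LinearMap.range N.mulVecLin))
  rintro _ ⟨c, rfl⟩
  rw [Matrix.mulVecLin_apply, Matrix.add_mulVec]
  exact Submodule.add_mem_sup ⟨c, rfl⟩ ⟨c, rfl⟩

/-- The first block column factors through `B`, and the second has only `card τ` columns. -/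
theorem rank_fromBlocks_le_rank_add_card [Fintype μ] [Fintype κ]
    (B : Matrix μ ν F) (X : Matrix μ τ F) (D : Matrix κ τ F) :
    (Matrix.fromBlocks B X 0 D).rank ≤ B.rank + Fintype.card τ := by
  classical
  have h : Matrix.fromBlocks B X 0 D =
      Matrix.fromRows (1 : Matrix μ μ F) (0 : Matrix κ μ F) * B *
        Matrix.fromCols (1 : Matrix ν ν F) (0 : Matrix ν τ F) +
      Matrix.fromRows X D * Matrix.fromCols (0 : Matrix τ ν F) (1 : Matrix τ τ F) := by
    simp only [Matrix.fromRows_mul, Matrix.one_mul, Matrix.zero_mul, Matrix.mul_fromCols,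
      Matrix.mul_one, Matrix.mul_zero]
    ext (i | i) (j | j) <;> simp
  rw [h]
  refine (rank_add_le _ _).trans (Nat.add_le_add ?_ ?_)
  · exact (Matrix.rank_mul_le_left _ _).trans (Matrix.rank_mul_le_right _ _)
  · exact (Matrix.rank_mul_le_left _ _).trans (Matrix.rank_le_card_width _)

/-- The upper block row has only `card μ` rows, and the lower one factors through `D`. -/
theorem rank_fromBlocks_le_card_add_rank [Fintype μ] [Fintype κ]
    (B : Matrix μ ν F) (X : Matrix μ τ F) (D : Matrix κ τ F) :
    (Matrix.fromBlocks B X 0 D).rank ≤ Fintype.card μ + D.rank := by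
  classical
  have h : Matrix.fromBlocks B X 0 D =
      Matrix.fromRows (1 : Matrix μ μ F) (0 : Matrix κ μ F) * Matrix.fromCols B X +
      Matrix.fromRows (0 : Matrix μ κ F) (1 : Matrix κ κ F) * D *
        Matrix.fromCols (0 : Matrix τ ν F) (1 : Matrix τ τ F) := by
    simp only [Matrix.fromRows_mul, Matrix.one_mul, Matrix.zero_mul, Matrix.mul_fromCols,
      Matrix.mul_one, Matrix.mul_zero]
    ext (i | i) (j | j) <;> simp
  rw [h]
  refine (rank_add_le _ _).trans (Nat.add_le_add ?_ ?_)
  · exact (Matrix.rank_mul_le_left _ _).trans (Matrix.rank_le_card_width _)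
  · exact (Matrix.rank_mul_le_left _ _).trans (Matrix.rank_mul_le_right _ _)

theorem rank_fromBlocks_eq [Fintype μ] [Fintype κ]
    (B : Matrix μ ν F) (X : Matrix μ τ F) (D : Matrix κ τ F)
    (hB : B.rank = Fintype.card μ) (hD : D.rank = Fintype.card τ) :
    (Matrix.fromBlocks B X 0 D).rank = Fintype.card μ + Fintype.card τ := by
  classical
  refine le_antisymm (hB ▸ rank_fromBlocks_le_rank_add_card B X D) ?_
  rw [rank_eq_card_height_iff] at hB
  rw [rank_eq_card_width_iff] at hD
  -- The columns of `diag(1, D)` are independent, and its column space lies in that of the given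
  -- matrix, because `B` is onto and so can correct any upper part.
  have h1 : (Matrix.fromBlocks (1 : Matrix μ μ F) 0 0 D).rank = Fintype.card (μ ⊕ τ) := by
    rw [rank_eq_card_width_iff]
    intro c hc
    rw [Matrix.fromBlocks_mulVec] at hc
    have hl : c ∘ Sum.inl = 0 := funext fun i => by simpa using congrFun hc (Sum.inl i)
    have hr : c ∘ Sum.inr = 0 := hD _ (funext fun i => by simpa using congrFun hc (Sum.inr i))
    ext (i | i)
    · exact congrFun hl i
    · exact congrFun hr i
  rw [← Fintype.card_sum, ← h1]
  refine Submodule.finrank_mono ?_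
  rintro _ ⟨c, rfl⟩
  obtain ⟨b, hb⟩ := hB (c ∘ Sum.inl - X.mulVec (c ∘ Sum.inr))
  refine ⟨Sum.elim b (c ∘ Sum.inr), ?_⟩
  simp [Matrix.fromBlocks_mulVec, hb]

/-- Adjoining a column to a matrix with independent columns keeps them independent exactly when the
new column is not in the span of the old ones. -/
theorem rank_fromCols_replicateCol_eq_iff (M : Matrix μ ν F) (v : μ → F)
    (hM : M.rank = Fintype.card ν) :
    (Matrix.fromCols M (Matrix.replicateCol Unit v)).rank = Fintype.card ν + 1 ↔
      ¬ ∃ c, M.mulVec c = v := by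
  rw [rank_eq_card_width_iff] at hM
  have h1 : Fintype.card ν + 1 = Fintype.card (ν ⊕ Unit) := by simp
  have hmul : ∀ c, (Matrix.fromCols M (Matrix.replicateCol Unit v)).mulVec c =
      M.mulVec (c ∘ Sum.inl) + c (Sum.inr ()) • v := by
    intro c
    rw [Matrix.fromCols_mulVec]
    congr 1
    ext i
    simp [Matrix.mulVec, dotProduct, mul_comm]
  rw [h1, rank_eq_card_width_iff]
  constructor
  · rintro h ⟨c, hc⟩
    have := h (Sum.elim c fun _ => -1) (by rw [hmul]; simp [hc])
    simpa using congrFun this (Sum.inr ())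
  · intro h c hc
    rw [hmul] at hc
    have h0 : c (Sum.inr ()) = 0 := by
      by_contra h0
      refine h ⟨-(c (Sum.inr ()))⁻¹ • (c ∘ Sum.inl), ?_⟩
      rw [Matrix.mulVec_smul, eq_neg_of_add_eq_zero_left hc]
      simp [smul_smul, h0]
    have hl := hM (c ∘ Sum.inl) (by simpa [h0] using hc)
    ext (i | i)
    · exact congrFun hl i
    · exact h0

/-- Deleting a row keeps the rank exactly when the unit vector of this row is not in the span of
the columns. -/
theorem rank_deleteRow_eq_iff [DecidableEq μ] (M : Matrix μ ν F) (i : μ) :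
    (deleteRow M i).rank = M.rank ↔ ¬ ∃ c, M.mulVec c = Pi.single i 1 := by
  have hmul : ∀ c, (deleteRow M i).mulVec c = fun k : {k // k ≠ i} => M.mulVec c k := fun c => rfl
  have h1 := M.mulVecLin.finrank_range_add_finrank_ker
  have h2 := (deleteRow M i).mulVecLin.finrank_range_add_finrank_ker
  have hle : LinearMap.ker M.mulVecLin ≤ LinearMap.ker (deleteRow M i).mulVecLin := by
    intro c hc
    rw [LinearMap.mem_ker, Matrix.mulVecLin_apply] at hc ⊢
    rw [hmul, hc]; rfl
  -- Both maps have the same domain, so by rank-nullity equal ranks mean equal kernels. A vector in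
  -- only the larger kernel is sent by `M` to a nonzero multiple of the unit vector.
  have h3 : (deleteRow M i).rank = M.rank ↔
      LinearMap.ker (deleteRow M i).mulVecLin ≤ LinearMap.ker M.mulVecLin := by
    constructor
    · intro h
      refine (Submodule.eq_of_le_of_finrank_eq hle ?_).ge
      rw [Matrix.rank, Matrix.rank] at h
      omega
    · intro h
      rw [le_antisymm h hle] at h2
      rw [Matrix.rank, Matrix.rank]
      omega
  rw [h3]
  constructor
  · rintro h ⟨c, hc⟩
    have : c ∈ LinearMap.ker M.mulVecLin := h (by
      rw [LinearMap.mem_ker, Matrix.mulVecLin_apply, hmul, hc]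
      ext k
      simp [k.2])
    rw [LinearMap.mem_ker, Matrix.mulVecLin_apply, hc] at this
    simpa using congrFun this i
  · intro h c hc
    rw [LinearMap.mem_ker, Matrix.mulVecLin_apply] at hc ⊢
    rw [hmul] at hc
    have hk : ∀ k, k ≠ i → M.mulVec c k = 0 := fun k hk => congrFun hc ⟨k, hk⟩
    have hi : M.mulVec c i = 0 := by
      by_contra hi
      refine h ⟨(M.mulVec c i)⁻¹ • c, ?_⟩
      rw [Matrix.mulVec_smul]
      ext k
      by_cases hki : k = i
      · subst hki; simp [hi]
      · simp [hki, hk k hki]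
    ext k
    by_cases hki : k = i
    · subst hki; exact hi
    · exact hk k hki

/-- Deleting a column of the first block column. -/
theorem rank_deleteCol_fromBlocks_inl [DecidableEq ν] [DecidableEq τ] (B : Matrix μ ν F)
    (X : Matrix μ τ F) (D : Matrix κ τ F) (j : ν) :
    (deleteCol (Matrix.fromBlocks B X 0 D) (Sum.inl j)).rank =
      (Matrix.fromBlocks (deleteCol B j) X 0 D).rank := by
  let f : {k : ν // k ≠ j} ⊕ τ → {k : ν ⊕ τ // k ≠ Sum.inl j} :=
    Sum.elim (fun k => ⟨Sum.inl k.1, by simpa using k.2⟩) (fun k => ⟨Sum.inr k, by simp⟩)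
  have hf : Function.Bijective f := by
    constructor
    · rintro (⟨a, ha⟩ | a) (⟨b, hb⟩ | b) h <;> simp_all [f]
    · rintro ⟨a | a, ha⟩
      · exact ⟨Sum.inl ⟨a, by simpa using ha⟩, rfl⟩
      · exact ⟨Sum.inr a, rfl⟩
  rw [← Matrix.rank_submatrix _ (Equiv.refl _) (Equiv.ofBijective f hf)]
  congr 1
  ext (i | i) (k | k) <;> rfl

/-- Deleting a column of the second block column. -/
theorem rank_deleteCol_fromBlocks_inr [DecidableEq ν] [DecidableEq τ] (B : Matrix μ ν F)
    (X : Matrix μ τ F) (D : Matrix κ τ F) (j : τ) :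
    (deleteCol (Matrix.fromBlocks B X 0 D) (Sum.inr j)).rank =
      (Matrix.fromBlocks B (deleteCol X j) 0 (deleteCol D j)).rank := by
  let f : ν ⊕ {k : τ // k ≠ j} → {k : ν ⊕ τ // k ≠ Sum.inr j} :=
    Sum.elim (fun k => ⟨Sum.inl k, by simp⟩) (fun k => ⟨Sum.inr k.1, by simpa using k.2⟩)
  have hf : Function.Bijective f := by
    constructor
    · rintro (a | ⟨a, ha⟩) (b | ⟨b, hb⟩) h <;> simp_all [f]
    · rintro ⟨a | a, ha⟩
      · exact ⟨Sum.inl a, rfl⟩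
      · exact ⟨Sum.inr ⟨a, by simpa using ha⟩, rfl⟩
  rw [← Matrix.rank_submatrix _ (Equiv.refl _) (Equiv.ofBijective f hf)]
  congr 1
  ext (i | i) (k | k) <;> rfl

end Rank

/-! ### Affine polynomials and completions -/

/-- The values at the origin and at the unit vectors determine all coefficients, whatever the size
of `F`; in higher degree this fails over finite fields. -/
theorem eq_zero_of_totalDegree_le_one {F σ : Type*} [Field F] (p : MvPolynomial σ F)
    (hp : p.totalDegree ≤ 1) (h : ∀ x, eval x p = 0) : p = 0 := by
  classical
  have h0 : coeff 0 p = 0 := by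
    simpa [eval_zero, constantCoeff_eq] using h 0
  have hdeg : ∀ d ∈ p.support, ∃ k, d = Finsupp.single k 1 := by
    intro d hd
    have hd1 : d.degree ≤ 1 := (le_totalDegree hd).trans hp
    have hd0 : d ≠ 0 := by
      rintro rfl
      exact MvPolynomial.mem_support_iff.1 hd h0
    obtain ⟨k, hk⟩ := Finsupp.ne_iff.1 hd0
    have hle : Finsupp.single k 1 ≤ d :=
      Finsupp.single_le_iff.2 (Nat.one_le_iff_ne_zero.2 (by simpa using hk))
    have hadd := tsub_add_cancel_of_le hle
    refine ⟨k, ?_⟩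
    have hdeg0 : (d - Finsupp.single k 1).degree = 0 := by
      have h1 := congrArg Finsupp.degree hadd
      rw [map_add, Finsupp.degree_single] at h1
      omega
    rw [Finsupp.degree_eq_zero_iff] at hdeg0
    rw [← hadd, hdeg0, zero_add]
  ext d
  rw [coeff_zero]
  by_contra hd
  rw [← Ne, ← MvPolynomial.mem_support_iff] at hd
  obtain ⟨k, rfl⟩ := hdeg d hd
  have hk := h (Pi.single k 1)
  rw [eval_eq, Finset.sum_eq_single (Finsupp.single k 1)] at hk
  · rw [Finsupp.support_single _ one_ne_zero] at hk
    exact MvPolynomial.mem_support_iff.1 hd (by simpa using hk)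
  · intro d hd hne
    obtain ⟨l, rfl⟩ := hdeg d hd
    have hlk : l ≠ k := by rintro rfl; exact hne rfl
    rw [Finsupp.support_single _ one_ne_zero]
    simp [hlk]
  · intro h; exact absurd hd h

theorem hasConstantRank_iff {F σ μ ν : Type*} [Field F] [Fintype ν]
    {A : Matrix μ ν (MvPolynomial σ F)} {ρ : ℕ} :
    HasConstantRank A ρ ↔ ∀ x, (completion A x).rank = ρ := by
  rw [HasConstantRank, rankSet, Set.eq_singleton_iff_nonempty_unique_mem]
  simp [Set.range_nonempty]

theorem completion_deleteRow {F σ μ ν : Type*} [Field F] (A : Matrix μ ν (MvPolynomial σ F)) (i : μ)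
    (x : σ → F) : completion (deleteRow A i) x = deleteRow (completion A x) i := rfl

theorem completion_deleteCol {F σ μ ν : Type*} [Field F] (A : Matrix μ ν (MvPolynomial σ F)) (j : ν)
    (x : σ → F) : completion (deleteCol A j) x = deleteCol (completion A x) j := rfl

theorem eval_congr_vars {F σ : Type*} [Field F] {p : MvPolynomial σ F} {x y : σ → F}
    (h : ∀ k ∈ p.vars, x k = y k) : eval x p = eval y p :=
  eval₂Hom_congr' rfl (fun k hk _ => h k hk) rfl

/-- The columns of an ACI-matrix can be completed independently of each other. -/
theorem IsACI.exists_completion_col {F σ μ ν : Type*} [Field F]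
    {A : Matrix μ ν (MvPolynomial σ F)} (hA : IsACI A) (y : ν → σ → F) :
    ∃ x, ∀ i j, completion A x i j = completion A (y j) i j := by
  classical
  -- Each indeterminate takes its value from the assignment of the only column in which it occurs.
  refine ⟨fun k => if h : ∃ j i, k ∈ (A i j).vars then y h.choose k else 0, fun i j => ?_⟩
  refine eval_congr_vars fun k hk => ?_
  have h : ∃ j i, k ∈ (A i j).vars := ⟨j, i, hk⟩
  have hj : h.choose = j := by
    by_contra hne
    obtain ⟨i', hi'⟩ := h.choose_spec
    exact hA.independent _ _ hne i' i k hi' hk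
  simp only [dif_pos h, hj]

/-- An ACI-matrix of constant rank `ρ` has a set `J` of columns that spans, over all completions,
a subspace whose dimension together with the number of the other columns is at most `ρ`. -/
theorem IsACI.exists_finset_finrank_le {F σ μ ν : Type*} [Field F] [Fintype μ] [Fintype ν]
    {A : Matrix μ ν (MvPolynomial σ F)} (hA : IsACI A) {ρ : ℕ} (hρ : ρ < Fintype.card ν)
    (hr : HasConstantRank A ρ) :
    ∃ J : Finset ν, finrank F (Submodule.span F
      (⋃ j ∈ J, Set.range fun x => (completion A x).col j)) + Fintype.card ν ≤ ρ + J.card := by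
  by_contra! h
  -- With this defect a transversal has rank at least `ρ + 1`; the subtraction does not truncate
  -- since `ρ < card ν`.
  obtain ⟨v, hv, hvcard⟩ := exists_transversal_finrank (F := F) (Fintype.card ν - (ρ + 1))
    (fun j => Set.range fun x => (completion A x).col j) (fun j => Set.range_nonempty _)
    (fun J => by have := h J; omega)
  choose y hy using hv
  obtain ⟨x, hx⟩ := hA.exists_completion_col y
  have hxv : (completion A x).col = v := by
    ext j i
    rw [← hy j]
    exact hx i j
  have := hasConstantRank_iff.1 hr x
  rw [Matrix.rank_eq_finrank_span_cols, hxv] at this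
  omega

/-! ### Equivalence -/

theorem mul_permMatrix {R μ ν : Type*} [CommSemiring R] [Fintype ν] [DecidableEq ν]
    (A : Matrix μ ν R) (Q : Equiv.Perm ν) : A * Q.permMatrix R = A.submatrix id Q.symm :=
  PEquiv.mul_toMatrix_toPEquiv A Q

section Equivalent

variable {F σ μ ν : Type*} [Field F] [Fintype μ]

theorem completion_mul_submatrix (A : Matrix μ ν (MvPolynomial σ F)) (T : Matrix μ μ F)
    (f : ν → ν) (x : σ → F) :
    completion ((T.map (C : F →+* MvPolynomial σ F) * A).submatrix id f) x =
      T * (completion A x).submatrix id f := by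
  ext i j
  simp [completion, Matrix.mul_apply]

theorem IsACI.mul_submatrix {A : Matrix μ ν (MvPolynomial σ F)} (hA : IsACI A) (T : Matrix μ μ F)
    (f : Equiv.Perm ν) :
    IsACI ((T.map (C : F →+* MvPolynomial σ F) * A).submatrix id f) := by
  classical
  have hvars : ∀ i j, ∀ x ∈ ((T.map (C : F →+* MvPolynomial σ F) * A).submatrix id f i j).vars,
      ∃ k, x ∈ (A k (f j)).vars := by
    intro i j x hx
    rw [Matrix.submatrix_apply, Matrix.mul_apply] at hx
    obtain ⟨k, -, hk⟩ := Finset.mem_biUnion.1 (vars_sum_subset _ _ hx)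
    refine ⟨k, ?_⟩
    simpa using vars_mul _ _ hk
  constructor
  · intro i j
    rw [Matrix.submatrix_apply, Matrix.mul_apply]
    refine totalDegree_finsetSum_le fun k _ => (totalDegree_mul _ _).trans ?_
    simpa using hA.degree_le_one k (f j)
  · intro j j' hj i i' x hx hx'
    obtain ⟨k, hk⟩ := hvars _ _ _ hx
    obtain ⟨k', hk'⟩ := hvars _ _ _ hx'
    exact hA.independent _ _ (f.injective.ne hj) _ _ _ hk hk'

theorem equivalent_mul_submatrix [DecidableEq μ] [Fintype ν] [DecidableEq ν]
    {A : Matrix μ ν (MvPolynomial σ F)} (hA : IsACI A)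
    (T : Matrix μ μ F) (hT : T.det ≠ 0) (f : Equiv.Perm ν) :
    Equivalent A ((T.map (C : F →+* MvPolynomial σ F) * A).submatrix id f) :=
  ⟨hA, hA.mul_submatrix T f, T, f.symm, hT, by rw [mul_permMatrix, Equiv.symm_symm]⟩

theorem Equivalent.exists_completion_eq [DecidableEq μ] [Fintype ν] [DecidableEq ν]
    {A B : Matrix μ ν (MvPolynomial σ F)}
    (h : Equivalent A B) : ∃ (T : Matrix μ μ F) (f : Equiv.Perm ν), T.det ≠ 0 ∧
      ∀ x, completion B x = T * (completion A x).submatrix id f := by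
  obtain ⟨-, -, T, Q, hT, rfl⟩ := h
  exact ⟨T, Q.symm, hT, fun x => by rw [mul_permMatrix, completion_mul_submatrix]⟩

end Equivalent

/-! ### Tight families of matrices -/

/-- In a tight family, no column is redundant for all members at once, and each vector lies in
the column space of some member. -/
def Tight {F ι μ ν : Type*} [Field F] [Fintype ν] [DecidableEq ν] (M : ι → Matrix μ ν F) : Prop :=
  (∀ j, ∃ x, (deleteCol (M x) j).rank ≠ (M x).rank) ∧ ∀ w, ∃ x c, (M x).mulVec c = w

/-- The index types may change, so that this serves both equivalence of ACI-matrices and reindexing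
of block matrices. -/
theorem Tight.mul_submatrix {F ι μ ν μ' ν' : Type*} [Field F] [Fintype ν]
    [DecidableEq ν] [Fintype μ'] [DecidableEq μ'] [Fintype ν']
    [DecidableEq ν'] {M : ι → Matrix μ ν F} {N : ι → Matrix μ' ν' F} {T : Matrix μ' μ' F}
    (hT : T.det ≠ 0) (e : μ' ≃ μ) (f : ν' ≃ ν) (hN : ∀ x, N x = T * (M x).submatrix e f)
    (hM : Tight M) : Tight N := by
  constructor
  · intro j
    obtain ⟨x, hx⟩ := hM.1 (f j)
    refine ⟨x, ?_⟩
    have hdel : deleteCol (N x) j = T * (deleteCol (M x) (f j)).submatrix e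
        (f.subtypeEquiv fun k => (f.injective.ne_iff (x := k) (y := j)).symm) := by
      rw [hN]; rfl
    rwa [hdel, hN, Matrix.rank_mul_eq_right_of_det_ne_zero _ _ hT,
      Matrix.rank_mul_eq_right_of_det_ne_zero _ _ hT, Matrix.rank_submatrix, Matrix.rank_submatrix]
  · intro w
    obtain ⟨x, c, hc⟩ := hM.2 ((T⁻¹.mulVec w) ∘ e.symm)
    refine ⟨x, c ∘ f, ?_⟩
    rw [hN, ← Matrix.mulVec_mulVec, Matrix.submatrix_mulVec_equiv]
    have : ((c ∘ f) ∘ f.symm) = c := by ext; simp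
    rw [this, hc]
    have : (T⁻¹.mulVec w ∘ e.symm) ∘ e = T⁻¹.mulVec w := by ext; simp
    rw [this, Matrix.mulVec_mulVec, Matrix.mul_nonsing_inv _ (isUnit_iff_ne_zero.2 hT),
      Matrix.one_mulVec]

section Tight

variable {F ι μ ν : Type*} [Field F] [Fintype μ] [DecidableEq μ] [Fintype ν] [DecidableEq ν]

theorem tight_mul_submatrix_iff {μ' ν' : Type*} [Fintype μ'] [DecidableEq μ'] [Fintype ν']
    [DecidableEq ν'] {M : ι → Matrix μ ν F} {N : ι → Matrix μ' ν' F} {T : Matrix μ' μ' F}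
    (hT : T.det ≠ 0) (e : μ' ≃ μ) (f : ν' ≃ ν) (hN : ∀ x, N x = T * (M x).submatrix e f) :
    Tight N ↔ Tight M := by
  refine ⟨Tight.mul_submatrix (T := (T⁻¹).submatrix e.symm e.symm) ?_ e.symm f.symm fun x => ?_,
    Tight.mul_submatrix hT e f hN⟩
  · rw [Matrix.det_submatrix_equiv_self]
    exact (Matrix.isUnit_nonsing_inv_det _ (isUnit_iff_ne_zero.2 hT)).ne_zero
  · rw [hN, ← Matrix.submatrix_mul_equiv _ _ e.symm e.symm, ← Matrix.mul_assoc,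
      Matrix.submatrix_mul_equiv, Matrix.nonsing_inv_mul _ (isUnit_iff_ne_zero.2 hT)]
    simp

/-- `T` is the inverse of the identity matrix with column `i` replaced by `w`, whose determinant is
`w i`. -/
theorem exists_det_ne_zero_mulVec_eq_single {w : μ → F} {i : μ} (hw : w i ≠ 0) :
    ∃ T : Matrix μ μ F, T.det ≠ 0 ∧ T.mulVec w = Pi.single i 1 := by
  let S := (1 : Matrix μ μ F).updateCol i w
  have hS : IsUnit S.det := by
    rw [← Matrix.cramer_apply, Matrix.cramer_one]
    exact isUnit_iff_ne_zero.2 hw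
  have hSw : S.mulVec (Pi.single i 1) = w := by
    rw [Matrix.mulVec_single_one]
    ext k
    simp [S]
  refine ⟨S⁻¹, (Matrix.isUnit_nonsing_inv_det _ hS).ne_zero, ?_⟩
  rw [← hSw, Matrix.mulVec_mulVec, Matrix.nonsing_inv_mul _ hS, Matrix.one_mulVec]

/-- Row `i` of `T A` can be deleted exactly when `T⁻¹ eᵢ` is in the column space of no completion of
`A`. As `T` and `i` vary, `T⁻¹ eᵢ` runs through all nonzero vectors. Column deletion does not see
`T`. -/
theorem isCompletelyIrreducible_iff_tight {σ : Type*} {A : Matrix μ ν (MvPolynomial σ F)}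
    (hA : IsACI A) {ρ : ℕ} (hr : HasConstantRank A ρ) :
    IsCompletelyIrreducible A ↔ Tight (completion A) := by
  have hr' := hasConstantRank_iff.1 hr
  constructor
  · rintro ⟨-, h⟩
    have hB : ∀ T : Matrix μ μ F, T.det ≠ 0 → ∃ B : Matrix μ ν (MvPolynomial σ F),
        IsIrreducible B ∧ (∀ x, completion B x = T * completion A x) ∧
        ∀ x, (completion B x).rank = ρ := by
      intro T hT
      have hc : ∀ x, completion ((T.map (C : F →+* MvPolynomial σ F) * A).submatrix id
          (Equiv.refl ν)) x = T * completion A x := fun x => completion_mul_submatrix A T _ x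
      refine ⟨_, h _ (equivalent_mul_submatrix hA T hT (Equiv.refl ν)), hc, fun x => ?_⟩
      rw [hc, Matrix.rank_mul_eq_right_of_det_ne_zero _ _ hT, hr']
    constructor
    · intro j
      by_contra! hj
      obtain ⟨B, hirr, hBA, hBr⟩ := hB 1 (by simp)
      refine hirr.2.2 ⟨ρ, hasConstantRank_iff.2 hBr, j, hasConstantRank_iff.2 fun x => ?_⟩
      rw [completion_deleteCol, hBA, Matrix.one_mul, hj, hr']
    · intro w
      by_cases hw : w = 0
      · exact ⟨0, 0, by simp [hw]⟩
      obtain ⟨i, hi⟩ := Function.ne_iff.1 hw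
      obtain ⟨T, hT, hTw⟩ := exists_det_ne_zero_mulVec_eq_single hi
      obtain ⟨B, hirr, hBA, hBr⟩ := hB T hT
      by_contra! hx
      refine hirr.2.1 ⟨ρ, hasConstantRank_iff.2 hBr, i, hasConstantRank_iff.2 fun x => ?_⟩
      rw [completion_deleteRow, ← hBr x, rank_deleteRow_eq_iff]
      rintro ⟨c, hc⟩
      refine hx x c (Matrix.mulVec_injective_of_isUnit ((Matrix.isUnit_iff_isUnit_det T).2
        (isUnit_iff_ne_zero.2 hT)) ?_)
      rw [hTw, ← hc, hBA, Matrix.mulVec_mulVec]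
  · intro h
    refine ⟨⟨ρ, hr⟩, fun B hB => ?_⟩
    obtain ⟨T, f, hT, hBA⟩ := hB.exists_completion_eq
    have hBt : Tight (completion B) := h.mul_submatrix hT (Equiv.refl _) f hBA
    have hBr : ∀ x, (completion B x).rank = ρ := fun x => by
      rw [hBA, Matrix.rank_mul_eq_right_of_det_ne_zero _ _ hT, ← hr' x]
      exact Matrix.rank_submatrix _ (Equiv.refl _) f
    refine ⟨⟨ρ, hasConstantRank_iff.2 hBr⟩, ?_, ?_⟩
    · rintro ⟨ρ', h1, i, h2⟩
      obtain ⟨x, c, hc⟩ := hBt.2 (Pi.single i 1)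
      refine (rank_deleteRow_eq_iff (completion B x) i).1 ?_ ⟨c, hc⟩
      rw [hasConstantRank_iff.1 h1 x, ← completion_deleteRow, hasConstantRank_iff.1 h2 x]
    · rintro ⟨ρ', h1, j, h2⟩
      obtain ⟨x, hx⟩ := hBt.1 j
      refine hx ?_
      rw [hasConstantRank_iff.1 h1 x, ← completion_deleteCol, hasConstantRank_iff.1 h2 x]

end Tight

/-! ### Block triangular families -/

/-- Since `B x` is onto, only the lower part of a vector can obstruct its being in the column space.
Deleting a column of the second block column always lowers the rank, since `D x` has independent
columns. -/
theorem tight_fromBlocks_iff {F ι μ ν κ τ : Type*} [Field F] [Fintype μ] [Fintype ν] [DecidableEq ν]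
    [Fintype κ] [Fintype τ] [DecidableEq τ] (B : ι → Matrix μ ν F) (X : ι → Matrix μ τ F)
    (D : ι → Matrix κ τ F) (hB : ∀ x, (B x).rank = Fintype.card μ)
    (hD : ∀ x, (D x).rank = Fintype.card τ) :
    Tight (fun x => Matrix.fromBlocks (B x) (X x) 0 (D x)) ↔
      (∀ j, ∃ x, (deleteCol (B x) j).rank ≠ Fintype.card μ) ∧ ∀ v, ∃ x c, (D x).mulVec c = v := by
  constructor
  · rintro ⟨h1, h2⟩
    constructor
    · intro j
      obtain ⟨x, hx⟩ := h1 (Sum.inl j)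
      refine ⟨x, fun h => hx ?_⟩
      rw [rank_deleteCol_fromBlocks_inl, rank_fromBlocks_eq _ _ _ h (hD x),
        rank_fromBlocks_eq _ _ _ (hB x) (hD x)]
    · intro v
      obtain ⟨x, c, hc⟩ := h2 (Sum.elim 0 v)
      refine ⟨x, c ∘ Sum.inr, ?_⟩
      rw [Matrix.fromBlocks_mulVec] at hc
      ext i
      simpa using congrFun hc (Sum.inr i)
  · rintro ⟨h1, h2⟩
    constructor
    · rintro (j | j)
      · obtain ⟨x, hx⟩ := h1 j
        refine ⟨x, ?_⟩
        have hle := rank_fromBlocks_le_rank_add_card (deleteCol (B x) j) (X x) (D x)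
        have hcard := (deleteCol (B x) j).rank_le_card_height
        rw [rank_deleteCol_fromBlocks_inl, rank_fromBlocks_eq _ _ _ (hB x) (hD x)]
        omega
      -- This only provides some index `x`; any one would do.
      · obtain ⟨x, -⟩ := h2 0
        refine ⟨x, ?_⟩
        have hle := rank_fromBlocks_le_card_add_rank (B x) (deleteCol (X x) j) (deleteCol (D x) j)
        have hcard := (deleteCol (D x) j).rank_le_card_width
        have hpos : 0 < Fintype.card τ := Fintype.card_pos_iff.2 ⟨j⟩
        rw [Fintype.card_subtype_compl, Fintype.card_subtype_eq] at hcard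
        rw [rank_deleteCol_fromBlocks_inr, rank_fromBlocks_eq _ _ _ (hB x) (hD x)]
        omega
    · intro w
      obtain ⟨x, c, hc⟩ := h2 (w ∘ Sum.inr)
      obtain ⟨b, hb⟩ := (rank_eq_card_height_iff _).1 (hB x) (w ∘ Sum.inl - (X x).mulVec c)
      refine ⟨x, Sum.elim b c, ?_⟩
      ext (i | i) <;> simp [Matrix.fromBlocks_mulVec, hb, hc]

/-! ### Minimal and maximal full rank in terms of completions -/

section FullRank

variable {F σ μ ν : Type*} [Field F] [Fintype ν] {A : Matrix μ ν (MvPolynomial σ F)}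

theorem HasConstantRank.eq {ρ ρ' : ℕ} (h : HasConstantRank A ρ) (h' : HasConstantRank A ρ') :
    ρ = ρ' :=
  (hasConstantRank_iff.1 h 0).symm.trans (hasConstantRank_iff.1 h' 0)

/-- After a deletion there are still at least `card μ` columns, so full rank still means rank `card
μ`. -/
theorem isMinimalFullRank_iff [Fintype μ] [DecidableEq ν] (hcard : Fintype.card μ < Fintype.card ν)
    (hA : ∀ x, (completion A x).rank = Fintype.card μ) :
    IsMinimalFullRank A ↔ ∀ j, ∃ x, (deleteCol (completion A x) j).rank ≠ Fintype.card μ := by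
  have hdel : ∀ j, ¬ IsFullRank (deleteCol A j) ↔
      ∃ x, (deleteCol (completion A x) j).rank ≠ Fintype.card μ := by
    intro j
    rw [IsFullRank, hasConstantRank_iff, not_forall, Fintype.card_subtype_compl,
      Fintype.card_subtype_eq, min_eq_left (by omega)]
    rfl
  rw [IsMinimalFullRank, forall_congr' hdel]
  refine ⟨fun h => h.2.2, fun h => ⟨?_, hcard, h⟩⟩
  rw [IsFullRank, min_eq_left hcard.le]
  exact hasConstantRank_iff.2 hA

/-- The augmented matrix is still no wider than high, so its full rank is `card ν + 1`, which a
completion misses exactly when its columns span `v`. -/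
theorem isMaximalFullRank_iff [Fintype μ] (hcard : Fintype.card ν < Fintype.card μ)
    (hA : ∀ x, (completion A x).rank = Fintype.card ν) :
    IsMaximalFullRank A ↔ ∀ v, ∃ x c, (completion A x).mulVec c = v := by
  have haug : ∀ v x, completion (augment A v) x =
      Matrix.fromCols (completion A x) (Matrix.replicateCol Unit v) := by
    intro v x
    ext i (j | j) <;> simp [completion, augment]
  have hnot : ∀ v, ¬ IsFullRank (augment A v) ↔ ∃ x c, (completion A x).mulVec c = v := by
    intro v
    rw [IsFullRank, hasConstantRank_iff, not_forall, Fintype.card_sum, Fintype.card_unit,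
      min_eq_right (by omega)]
    refine exists_congr fun x => ?_
    rw [haug, rank_fromCols_replicateCol_eq_iff _ _ (hA x), not_not]
  rw [IsMaximalFullRank, forall_congr' hnot]
  refine ⟨fun h => h.2.2, fun h => ⟨?_, hcard, h⟩⟩
  rw [IsFullRank, min_eq_right hcard.le]
  exact hasConstantRank_iff.2 hA

end FullRank

theorem completion_blockUpper {F σ : Type*} [Field F] {m n p q r s : ℕ} (hm : p + r = m)
    (hn : q + s = n) (A₁₁ : Matrix (Fin p) (Fin q) (MvPolynomial σ F))
    (A₁₂ : Matrix (Fin p) (Fin s) (MvPolynomial σ F))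
    (A₂₂ : Matrix (Fin r) (Fin s) (MvPolynomial σ F)) (x : σ → F) :
    completion (blockUpper hm hn A₁₁ A₁₂ A₂₂) x =
      (Matrix.fromBlocks (completion A₁₁ x) (completion A₁₂ x) 0 (completion A₂₂ x)).submatrix
        (finSumFinEquiv.trans (finCongr hm)).symm (finSumFinEquiv.trans (finCongr hn)).symm := by
  rw [blockUpper, Matrix.reindex_apply, completion, ← Matrix.submatrix_map, Matrix.fromBlocks_map]
  simp [completion]

/-- For a matrix equivalent to a block triangular one with blocks of full rank, complete
irreducibility is minimality of the first diagonal block and maximality of the second. -/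
theorem isCompletelyIrreducible_iff_of_equivalent_blockUpper {F σ : Type*} [Field F]
    {m n p q r s : ℕ} {A : Matrix (Fin m) (Fin n) (MvPolynomial σ F)} (hm : p + r = m)
    (hn : q + s = n) {A₁₁ : Matrix (Fin p) (Fin q) (MvPolynomial σ F)}
    {A₁₂ : Matrix (Fin p) (Fin s) (MvPolynomial σ F)}
    {A₂₂ : Matrix (Fin r) (Fin s) (MvPolynomial σ F)}
    (h : Equivalent A (blockUpper hm hn A₁₁ A₁₂ A₂₂)) (hpq : p < q) (hsr : s < r)
    (h₁ : HasConstantRank A₁₁ p) (h₂ : HasConstantRank A₂₂ s) :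
    HasConstantRank A (p + s) ∧
      (IsCompletelyIrreducible A ↔ IsMinimalFullRank A₁₁ ∧ IsMaximalFullRank A₂₂) := by
  obtain ⟨T, f, hT, hc⟩ := h.exists_completion_eq
  have hrank₁ : ∀ x, (completion A₁₁ x).rank = Fintype.card (Fin p) := by
    simpa using hasConstantRank_iff.1 h₁
  have hrank₂ : ∀ x, (completion A₂₂ x).rank = Fintype.card (Fin s) := by
    simpa using hasConstantRank_iff.1 h₂
  have hr : HasConstantRank A (p + s) := hasConstantRank_iff.2 fun x => by
    have h1 := rank_fromBlocks_eq _ (completion A₁₂ x) _ (hrank₁ x) (hrank₂ x)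
    rw [← Matrix.rank_submatrix _ (finSumFinEquiv.trans (finCongr hm)).symm
      (finSumFinEquiv.trans (finCongr hn)).symm, ← completion_blockUpper, hc,
      Matrix.rank_mul_eq_right_of_det_ne_zero _ _ hT] at h1
    rw [← Matrix.rank_submatrix _ (Equiv.refl _) f]
    simpa using h1
  refine ⟨hr, ?_⟩
  rw [isCompletelyIrreducible_iff_tight h.1 hr,
    ← tight_mul_submatrix_iff hT (Equiv.refl _) f hc,
    tight_mul_submatrix_iff (T := 1) (by simp) _ _
      (fun x => by rw [completion_blockUpper, Matrix.one_mul]),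
    tight_fromBlocks_iff _ _ _ hrank₁ hrank₂, isMinimalFullRank_iff (by simpa using hpq) hrank₁,
    isMaximalFullRank_iff (by simpa using hsr) hrank₂]

/-! ### Block triangular form -/

/-- Some nonsingular matrix maps a given subspace of dimension `p` to the vectors supported on the
first `p` coordinates. -/
theorem exists_det_ne_zero_mulVec_natAdd_eq_zero {F : Type*} [Field F] {p r : ℕ}
    (U : Submodule F (Fin (p + r) → F)) (hU : finrank F U = p) :
    ∃ T : Matrix (Fin (p + r)) (Fin (p + r)) F, T.det ≠ 0 ∧
      ∀ u ∈ U, ∀ i : Fin r, T.mulVec u (Fin.natAdd p i) = 0 := by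
  obtain ⟨W, hW⟩ := U.exists_isCompl
  have hWr : finrank F W = r := by
    have := Submodule.finrank_add_eq_of_isCompl hW
    rw [Module.finrank_fintype_fun_eq_card, Fintype.card_fin] at this
    omega
  -- A basis of `U` followed by one of a complement; `T` takes coordinates in it.
  let b : Basis (Fin (p + r)) F (Fin (p + r) → F) :=
    (((finBasisOfFinrankEq F U hU).prod (finBasisOfFinrankEq F W hWr)).map
      (Submodule.prodEquivOfIsCompl U W hW)).reindex finSumFinEquiv
  refine ⟨b.toMatrix (Pi.basisFun F (Fin (p + r))), ?_, fun u hu i => ?_⟩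
  · let _ := b.invertibleToMatrix (Pi.basisFun F (Fin (p + r)))
    exact (Matrix.isUnit_det_of_invertible _).ne_zero
  · have h := (Pi.basisFun F (Fin (p + r))).toMatrix_mulVec_repr b u
    have hu' : ⇑((Pi.basisFun F (Fin (p + r))).repr u) = u := by ext; simp
    rw [hu'] at h
    rw [h]
    have hfu : (Submodule.prodEquivOfIsCompl U W hW).symm u = (⟨u, hu⟩, 0) :=
      Submodule.prodEquivOfIsCompl_symm_apply_left U W hW ⟨u, hu⟩
    simp [b, hfu]

/-- An ACI-matrix of constant rank is equivalent to a block triangular one whose diagonal blocks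
have full row rank and full column rank. -/
theorem IsACI.exists_equivalent_blockUpper {F σ : Type*} [Field F] {m n : ℕ}
    {A : Matrix (Fin m) (Fin n) (MvPolynomial σ F)} (hA : IsACI A) {ρ : ℕ} (hρ : ρ < min m n)
    (hr : HasConstantRank A ρ) :
    ∃ (p q r s : ℕ) (hm : p + r = m) (hn : q + s = n)
      (A₁₁ : Matrix (Fin p) (Fin q) (MvPolynomial σ F))
      (A₁₂ : Matrix (Fin p) (Fin s) (MvPolynomial σ F))
      (A₂₂ : Matrix (Fin r) (Fin s) (MvPolynomial σ F)),
      Equivalent A (blockUpper hm hn A₁₁ A₁₂ A₂₂) ∧ p + s = ρ ∧ p < q ∧ s < r ∧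
        HasConstantRank A₁₁ p ∧ HasConstantRank A₂₂ s := by
  have hr' := hasConstantRank_iff.1 hr
  obtain ⟨J, hJ⟩ := hA.exists_finset_finrank_le (by simp; omega) hr
  rw [Fintype.card_fin] at hJ
  generalize hUdef : Submodule.span F
    (⋃ j ∈ J, Set.range fun x => (completion A x).col j) = U at hJ
  have hUm : finrank F U ≤ m := by simpa using U.finrank_le
  have hJn : J.card ≤ n := by simpa using J.card_le_univ
  obtain ⟨p, hp⟩ : ∃ p, finrank F U = p := ⟨_, rfl⟩
  obtain ⟨q, hq⟩ : ∃ q, J.card = q := ⟨_, rfl⟩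
  rw [hp] at hUm hJ
  rw [hq] at hJn hJ
  obtain ⟨r, rfl⟩ := Nat.exists_eq_add_of_le hUm
  obtain ⟨s, rfl⟩ := Nat.exists_eq_add_of_le hJn
  obtain ⟨T, hT, hTU⟩ := exists_det_ne_zero_mulVec_natAdd_eq_zero U hp
  have hqc : (Jᶜ).card = s := by rw [Finset.card_compl, hq]; simp
  let f : Equiv.Perm (Fin (q + s)) := finSumFinEquiv.symm.trans (finSumEquivOfFinset hq hqc)
  have hfJ : ∀ j : Fin q, f (Fin.castAdd s j) ∈ J := by
    intro j
    simp [f]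
  have hN := equivalent_mul_submatrix hA T hT f
  have hNc := completion_mul_submatrix A T f
  generalize (T.map (C : F →+* MvPolynomial σ F) * A).submatrix id f = N at hN hNc
  have hzero : ∀ (i : Fin r) (j : Fin q), N (Fin.natAdd p i) (Fin.castAdd s j) = 0 := by
    intro i j
    refine eq_zero_of_totalDegree_le_one _ (hN.2.1.degree_le_one _ _) fun x => ?_
    have hmem : (completion A x).col (f (Fin.castAdd s j)) ∈ U := by
      rw [← hUdef]
      exact Submodule.subset_span (Set.mem_biUnion (hfJ j) ⟨x, rfl⟩)
    have h0 := hTU _ hmem i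
    have h1 := congrFun (congrFun (hNc x) (Fin.natAdd p i)) (Fin.castAdd s j)
    exact h1.trans h0
  have hblock : N = blockUpper rfl rfl
      (N.submatrix (Fin.castAdd r) (Fin.castAdd s)) (N.submatrix (Fin.castAdd r) (Fin.natAdd q))
      (N.submatrix (Fin.natAdd p) (Fin.natAdd q)) := by
    rw [blockUpper, ← Equiv.symm_apply_eq]
    ext (i | i) (j | j) : 2 <;> simp [hzero]
  have hrank : ∀ x, (Matrix.fromBlocks (completion (N.submatrix (Fin.castAdd r) (Fin.castAdd s)) x)
      (completion (N.submatrix (Fin.castAdd r) (Fin.natAdd q)) x) 0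
      (completion (N.submatrix (Fin.natAdd p) (Fin.natAdd q)) x)).rank = ρ := by
    intro x
    rw [← Matrix.rank_submatrix _ (finSumFinEquiv.trans (finCongr rfl)).symm
      (finSumFinEquiv.trans (finCongr rfl)).symm, ← completion_blockUpper, ← hblock, hNc,
      Matrix.rank_mul_eq_right_of_det_ne_zero _ _ hT, ← hr' x]
    exact Matrix.rank_submatrix _ (Equiv.refl _) f
  have hle : ∀ x, ρ ≤ (completion (N.submatrix (Fin.castAdd r) (Fin.castAdd s)) x).rank + s ∧
      ρ ≤ p + (completion (N.submatrix (Fin.natAdd p) (Fin.natAdd q)) x).rank ∧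
      (completion (N.submatrix (Fin.castAdd r) (Fin.castAdd s)) x).rank ≤ p ∧
      (completion (N.submatrix (Fin.natAdd p) (Fin.natAdd q)) x).rank ≤ s := by
    intro x
    refine ⟨?_, ?_, Matrix.rank_le_height _, Matrix.rank_le_width _⟩
    · simpa [hrank x] using rank_fromBlocks_le_rank_add_card
        (completion (N.submatrix (Fin.castAdd r) (Fin.castAdd s)) x)
        (completion (N.submatrix (Fin.castAdd r) (Fin.natAdd q)) x)
        (completion (N.submatrix (Fin.natAdd p) (Fin.natAdd q)) x)
    · simpa [hrank x] using rank_fromBlocks_le_card_add_rank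
        (completion (N.submatrix (Fin.castAdd r) (Fin.castAdd s)) x)
        (completion (N.submatrix (Fin.castAdd r) (Fin.natAdd q)) x)
        (completion (N.submatrix (Fin.natAdd p) (Fin.natAdd q)) x)
  -- `hJ` says `p + s ≤ ρ` and `hle` gives the converse, so `p + s = ρ` and all bounds in `hle` are
  -- equalities. Then `ρ < q + s` and `ρ < p + r` yield `p < q` and `s < r`.
  have h0 := hle 0
  refine ⟨p, q, r, s, rfl, rfl, _, _, _, hblock ▸ hN, by omega, by omega, by omega,
    hasConstantRank_iff.2 fun x => ?_, hasConstantRank_iff.2 fun x => ?_⟩ <;>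
  · have := hle x
    omega

/-- Without rows every matrix has full rank 0, so a column could be deleted. -/
theorem IsMinimalFullRank.card_pos {F σ μ ν : Type*} [Field F] [Fintype μ] [Fintype ν]
    [DecidableEq ν] {A : Matrix μ ν (MvPolynomial σ F)} (h : IsMinimalFullRank A) :
    0 < Fintype.card μ := by
  by_contra h0
  have h1 := h.2.1
  obtain ⟨j⟩ : Nonempty ν := Fintype.card_pos_iff.1 (by omega)
  refine h.2.2 j (hasConstantRank_iff.2 fun x => ?_)
  have := (completion (deleteCol A j) x).rank_le_card_height
  omega

/-- Without columns the column space is zero and misses the all-ones vector. -/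
theorem IsMaximalFullRank.card_pos {F σ μ ν : Type*} [Field F] [Fintype μ] [Fintype ν]
    {A : Matrix μ ν (MvPolynomial σ F)} (h : IsMaximalFullRank A) :
    0 < Fintype.card ν := by
  by_contra h0
  have h1 := h.2.1
  obtain ⟨i⟩ : Nonempty μ := Fintype.card_pos_iff.1 (by omega)
  have : IsEmpty ν := Fintype.card_eq_zero_iff.1 (by omega)
  obtain ⟨x, c, hc⟩ := (isMaximalFullRank_iff h1 fun x => by
    have := (completion A x).rank_le_card_width
    omega).1 h 1
  have := congrFun hc i
  simp [Matrix.mulVec, dotProduct] at this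

end ACI

theorem mainTheorem2 {F : Type*} [Field F] {σ : Type*} {m n : ℕ}
    (A : Matrix (Fin m) (Fin n) (MvPolynomial σ F)) (hA : ACI.IsACI A)
    (ρ : ℕ) (hρ : 1 ≤ ρ) (hρ' : ρ < min m n) :
    (ACI.IsCompletelyIrreducible A ∧ ACI.HasConstantRank A ρ) ↔
      ∃ ρ₁ ρ₂ : ℕ, 0 < ρ₁ ∧ 0 < ρ₂ ∧ ρ₁ + ρ₂ = ρ ∧
        ∃ (p q r s : ℕ) (hm : p + r = m) (hn : q + s = n)
          (A₁₁ : Matrix (Fin p) (Fin q) (MvPolynomial σ F))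
          (A₁₂ : Matrix (Fin p) (Fin s) (MvPolynomial σ F))
          (A₂₂ : Matrix (Fin r) (Fin s) (MvPolynomial σ F)),
          ACI.Equivalent A (ACI.blockUpper hm hn A₁₁ A₁₂ A₂₂) ∧
          ACI.IsMinimalFullRank A₁₁ ∧ ACI.HasConstantRank A₁₁ ρ₁ ∧
          ACI.IsMaximalFullRank A₂₂ ∧ ACI.HasConstantRank A₂₂ ρ₂ := by
  constructor
  · rintro ⟨hirr, hr⟩
    obtain ⟨p, q, r, s, hm, hn, A₁₁, A₁₂, A₂₂, hE, hps, hpq, hsr, h₁, h₂⟩ :=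
      hA.exists_equivalent_blockUpper hρ' hr
    obtain ⟨hmin, hmax⟩ := (ACI.isCompletelyIrreducible_iff_of_equivalent_blockUpper
      hm hn hE hpq hsr h₁ h₂).2.1 hirr
    exact ⟨p, s, by simpa using hmin.card_pos, by simpa using hmax.card_pos, hps,
      p, q, r, s, hm, hn, A₁₁, A₁₂, A₂₂, hE, hmin, h₁, hmax, h₂⟩
  · rintro ⟨ρ₁, ρ₂, -, -, rfl, p, q, r, s, hm, hn, A₁₁, A₁₂, A₂₂, hE, hmin, h₁, hmax, h₂⟩
    have hpq : p < q := by simpa using hmin.2.1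
    have hsr : s < r := by simpa using hmax.2.1
    -- Full rank fixes the constant ranks: `min p q = p` and `min r s = s`.
    obtain rfl : ρ₁ = p := (h₁.eq hmin.1).trans (by simp; omega)
    obtain rfl : ρ₂ = s := (h₂.eq hmax.1).trans (by simp; omega)
    have h := ACI.isCompletelyIrreducible_iff_of_equivalent_blockUpper hm hn hE hpq hsr h₁ h₂
    exact ⟨h.2.2 ⟨hmin, hmax⟩, h.1⟩
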